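/- Let $M$ be a non-empty smooth 3-manifold (without boundary, not necessarily compact or connected) and let $g = \langle\cdot,\cdot\rangle$ be a smooth Riemannian metric on $M$, not necessarily complete, whose sectional curvature is constant and negative: there is $c<0$ such that every tangent plane at every point of $M$ has sectional curvature $c$. Let $\xi$ be any contact structure on $M$, that is, a plane field which near every point is the kernel of a smooth 1-form $\beta$ with $\beta\wedge d\beta$ nowhere zero. Then $g$ is not compatible with $\xi$. Here $g$ is called compatible with $\xi$ if there are a smooth contact form $\alpha$ on $M$ with $\ker\alpha=\xi$, an almost complex structure $J$ on $\xi$ (so $J^2=-\mathrm{id}$ on $\xi$) and a constant $k\in\mathbb{R}$ such that $$\langle N, X\rangle = \alpha(X), \qquad k\,\langle X, JY\rangle = d\alpha(X,Y)$$ for all vector fields $X, Y$ on $M$, where $N$ is the Reeb vector field of $\alpha$ (determined by $\alpha(N)=1$ and $\iota_N d\alpha=0$) and $J$ is extended to $TM$ by $JN=0$. In particular, no hyperbolic metric on $\mathbb{R}^3$ is compatible with a contact structure. -/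

import Mathlib

open Bundle VectorField
open scoped Manifold ContDiff Topology

noncomputable section

namespace ContactMetric

/-- The model space of 3-manifolds. -/
abbrev E3 : Type := EuclideanSpace ℝ (Fin 3)

variable {M : Type*} [TopologicalSpace M] [ChartedSpace E3 M]

/-! ### Smooth tensor fields and the exterior derivative of a 1-form -/

/-- The vector field `X` is smooth on `U`. -/
def SmoothField [IsManifold (𝓡 3) ∞ M] (X : Π p : M, TangentSpace (𝓡 3) p) (U : Set M) : Prop :=
  ContMDiffOn (𝓡 3) ((𝓡 3).prod 𝓘(ℝ, E3)) ∞
    (fun p ↦ TotalSpace.mk' E3 (E := fun p : M ↦ TangentSpace (𝓡 3) p) p (X p)) U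

/-- The vector field `X` is differentiable at `p`. -/
def DiffFieldAt [IsManifold (𝓡 3) ∞ M] (X : Π p : M, TangentSpace (𝓡 3) p) (p : M) : Prop :=
  MDifferentiableAt (𝓡 3) ((𝓡 3).prod 𝓘(ℝ, E3))
    (fun p ↦ TotalSpace.mk' E3 (E := fun p : M ↦ TangentSpace (𝓡 3) p) p (X p)) p

/-- The 1-form `α` is smooth on `U`. -/
def SmoothForm [IsManifold (𝓡 3) ∞ M] (α : Π p : M, TangentSpace (𝓡 3) p →L[ℝ] ℝ)
    (U : Set M) : Prop :=
  ContMDiffOn (𝓡 3) ((𝓡 3).prod 𝓘(ℝ, E3 →L[ℝ] ℝ)) ∞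
    (fun p ↦ TotalSpace.mk' (E3 →L[ℝ] ℝ)
      (E := fun p : M ↦ (TangentSpace (𝓡 3) p →L[ℝ] Bundle.Trivial M ℝ p)) p (α p)) U

/-- The field `J` of endomorphisms of the tangent spaces is smooth on `U`. -/
def SmoothEnd [IsManifold (𝓡 3) ∞ M]
    (J : Π p : M, TangentSpace (𝓡 3) p →L[ℝ] TangentSpace (𝓡 3) p) (U : Set M) : Prop :=
  ContMDiffOn (𝓡 3) ((𝓡 3).prod 𝓘(ℝ, E3 →L[ℝ] E3)) ∞
    (fun p ↦ TotalSpace.mk' (E3 →L[ℝ] E3)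
      (E := fun p : M ↦ (TangentSpace (𝓡 3) p →L[ℝ] TangentSpace (𝓡 3) p)) p (J p)) U

/-- `X(α(Y)) - Y(α(X)) - α([X, Y])` at `p`, for vector fields `X`, `Y`. -/
def dFormFields (α : Π p : M, TangentSpace (𝓡 3) p →L[ℝ] ℝ)
    (X Y : Π p : M, TangentSpace (𝓡 3) p) (p : M) : ℝ :=
  mvfderiv (𝓡 3) (fun q ↦ α q (Y q)) p (X p) - mvfderiv (𝓡 3) (fun q ↦ α q (X q)) p (Y p)
    - α p (mlieBracket (𝓡 3) X Y p)

/-- The exterior derivative `dα` at `p`, evaluated on tangent vectors `u`, `v`, through the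
invariant formula `dα(X, Y) = X(α(Y)) - Y(α(X)) - α([X, Y])` for vector fields `X`, `Y` that are
smooth near `p` with `X p = u` and `Y p = v`. The choice of `X`, `Y` does not matter
(`dForm_apply`). -/
def dForm [IsManifold (𝓡 3) ∞ M] (α : Π p : M, TangentSpace (𝓡 3) p →L[ℝ] ℝ) (p : M)
    (u v : TangentSpace (𝓡 3) p) : ℝ :=
  dFormFields α (FiberBundle.extend E3 u) (FiberBundle.extend E3 v) p

lemma dFormFields_swap {α : Π p : M, TangentSpace (𝓡 3) p →L[ℝ] ℝ} {p : M}
    (X Y : Π p : M, TangentSpace (𝓡 3) p) :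
    dFormFields α X Y p = - dFormFields α Y X p := by
  simp only [dFormFields, mlieBracket_swap_apply (V := X) (W := Y), map_neg]
  ring

section ExteriorDerivative

variable [IsManifold (𝓡 3) ∞ M] {α : Π p : M, TangentSpace (𝓡 3) p →L[ℝ] ℝ} {p : M}
  {U : Set M}

lemma mdifferentiableAt_pairing (hU : U ∈ 𝓝 p) (hα : SmoothForm α U)
    {X : Π p : M, TangentSpace (𝓡 3) p} (hX : DiffFieldAt X p) :
    MDifferentiableAt (𝓡 3) 𝓘(ℝ, ℝ) (fun q ↦ α q (X q)) p := by
  have h1 := (ContMDiffOn.contMDiffAt hα hU).mdifferentiableAt (by simp)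
  have h2 := MDifferentiableAt.clm_bundle_apply (F₁ := E3) (F₂ := ℝ)
    (E₁ := fun p : M ↦ TangentSpace (𝓡 3) p) (E₂ := Bundle.Trivial M ℝ) (b := id) h1 hX
  exact ((mdifferentiableAt_totalSpace _ _).1 h2).2

lemma tensorialAt_dFormFields_right (hU : U ∈ 𝓝 p) (hα : SmoothForm α U)
    (X : Π p : M, TangentSpace (𝓡 3) p) :
    TensorialAt (𝓡 3) E3 (dFormFields α X · p) p where
  smul {f Y} hf hY := by
    have e : (fun q ↦ α q ((f • Y) q)) = f * fun q ↦ α q (Y q) := by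
      ext q; simp
    have : IsManifold (𝓡 3) 2 M := IsManifold.of_le (n := ∞) (by norm_cast)
    have hp := mdifferentiableAt_pairing hU hα hY
    simp only [dFormFields, e, mvfderiv_mul hf hp,
      mlieBracket_smul_right hf hY]
    simp
    ring
  add {Y Y'} hY hY' := by
    have e : (fun q ↦ α q ((Y + Y') q)) = (fun q ↦ α q (Y q)) + fun q ↦ α q (Y' q) := by
      ext q; simp
    have : IsManifold (𝓡 3) 2 M := IsManifold.of_le (n := ∞) (by norm_cast)
    simp only [dFormFields, e, mvfderiv_add (mdifferentiableAt_pairing hU hα hY)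
      (mdifferentiableAt_pairing hU hα hY'), mlieBracket_add_right hY hY']
    simp
    ring

lemma tensorialAt_dFormFields_left (hU : U ∈ 𝓝 p) (hα : SmoothForm α U)
    (Y : Π p : M, TangentSpace (𝓡 3) p) :
    TensorialAt (𝓡 3) E3 (dFormFields α · Y p) p := by
  have h := tensorialAt_dFormFields_right hU hα Y
  constructor
  · intro f X hf hX
    rw [dFormFields_swap, h.smul hf hX, dFormFields_swap (X := X), smul_neg]
  · intro X X' hX hX'
    rw [dFormFields_swap, h.add hX hX', dFormFields_swap (X := X), dFormFields_swap (X := X')]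
    ring

/-- `dForm` satisfies the invariant formula for all vector fields differentiable at the point. -/
theorem dForm_apply (hU : U ∈ 𝓝 p) (hα : SmoothForm α U)
    {X Y : Π p : M, TangentSpace (𝓡 3) p} (hX : DiffFieldAt X p) (hY : DiffFieldAt Y p) :
    dForm α p (X p) (Y p) = dFormFields α X Y p :=
  TensorialAt.pointwise₂ (I := 𝓡 3) (F := E3) (F' := E3)
    (Φ := fun X Y ↦ dFormFields α X Y p)
    (fun τ _ ↦ tensorialAt_dFormFields_left hU hα τ)
    (fun σ _ ↦ tensorialAt_dFormFields_right hU hα σ)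
    (FiberBundle.mdifferentiableAt_extend ..) hX (FiberBundle.mdifferentiableAt_extend ..) hY (by simp) (by simp)

end ExteriorDerivative

/-! ### Contact structures -/

/-- The value of the 3-form `α ∧ dα` at `p` on the tangent vectors `u`, `v`, `w`. -/
def contactVolume [IsManifold (𝓡 3) ∞ M] (α : Π p : M, TangentSpace (𝓡 3) p →L[ℝ] ℝ) (p : M)
    (u v w : TangentSpace (𝓡 3) p) : ℝ :=
  α p u * dForm α p v w + α p v * dForm α p w u + α p w * dForm α p u v

/-- On the set `U`, `α` is a smooth contact form (`α ∧ dα` vanishes nowhere) with kernel the plane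
field `ξ`. -/
structure IsContactFormOn [IsManifold (𝓡 3) ∞ M] (α : Π p : M, TangentSpace (𝓡 3) p →L[ℝ] ℝ)
    (ξ : Π p : M, Submodule ℝ (TangentSpace (𝓡 3) p)) (U : Set M) : Prop where
  smooth : SmoothForm α U
  ker_eq : ∀ p ∈ U, ∀ u : TangentSpace (𝓡 3) p, u ∈ ξ p ↔ α p u = 0
  contact : ∀ p ∈ U, ∃ u v w : TangentSpace (𝓡 3) p, contactVolume α p u v w ≠ 0

/-- `ξ` is a contact structure: locally it is the kernel of a contact form. -/
def IsContactStructure [IsManifold (𝓡 3) ∞ M]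
    (ξ : Π p : M, Submodule ℝ (TangentSpace (𝓡 3) p)) : Prop :=
  ∀ p : M, ∃ U : Set M, IsOpen U ∧ p ∈ U ∧
    ∃ α : Π p : M, TangentSpace (𝓡 3) p →L[ℝ] ℝ, IsContactFormOn α ξ U

/-- `N` is the Reeb vector field of `α`: `α(N) = 1` and `ι_N dα = 0`. -/
structure IsReebField [IsManifold (𝓡 3) ∞ M] (α : Π p : M, TangentSpace (𝓡 3) p →L[ℝ] ℝ)
    (N : Π p : M, TangentSpace (𝓡 3) p) : Prop where
  smooth : SmoothField N Set.univ
  form_eq_one : ∀ p, α p (N p) = 1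
  contraction_eq_zero : ∀ (p : M) (u : TangentSpace (𝓡 3) p), dForm α p (N p) u = 0

/-- `J` is an almost complex structure on the plane field `ξ`, extended to the tangent bundle by
`J N = 0`. -/
structure IsAlmostComplex [IsManifold (𝓡 3) ∞ M]
    (ξ : Π p : M, Submodule ℝ (TangentSpace (𝓡 3) p)) (N : Π p : M, TangentSpace (𝓡 3) p)
    (J : Π p : M, TangentSpace (𝓡 3) p →L[ℝ] TangentSpace (𝓡 3) p) : Prop where
  smooth : SmoothEnd J Set.univ
  mem : ∀ (p : M), ∀ u ∈ ξ p, J p u ∈ ξ p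
  sq : ∀ (p : M), ∀ u ∈ ξ p, J p (J p u) = -u
  map_reeb : ∀ p : M, J p (N p) = 0

/-! ### Riemannian metrics

A Riemannian metric on `M` is an instance of Mathlib's `RiemannianBundle` on the tangent bundle. -/

section Metric

variable [IsManifold (𝓡 3) ∞ M] [RiemannianBundle (fun p : M ↦ TangentSpace (𝓡 3) p)]

/-- The Riemannian metric of `M` is compatible with the plane field `ξ`: there are a contact form
`α` with kernel `ξ`, with Reeb field `N`, an almost complex structure `J` on `ξ` and a constant `k`
with `⟨N, X⟩ = α(X)` and `k ⟨X, J Y⟩ = dα(X, Y)`. -/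
def MetricCompatibleWith (ξ : Π p : M, Submodule ℝ (TangentSpace (𝓡 3) p)) : Prop :=
  ∃ (α : Π p : M, TangentSpace (𝓡 3) p →L[ℝ] ℝ) (N : Π p : M, TangentSpace (𝓡 3) p)
    (J : Π p : M, TangentSpace (𝓡 3) p →L[ℝ] TangentSpace (𝓡 3) p) (k : ℝ),
    IsContactFormOn α ξ Set.univ ∧ IsReebField α N ∧ IsAlmostComplex ξ N J ∧
    (∀ (p : M) (u : TangentSpace (𝓡 3) p), inner ℝ (N p) u = α p u) ∧
    ∀ (p : M) (u v : TangentSpace (𝓡 3) p), k * inner ℝ u (J p v) = dForm α p u v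

instance instRiemannianOne
    [h : IsContMDiffRiemannianBundle (𝓡 3) ∞ E3 (fun p : M ↦ TangentSpace (𝓡 3) p)] :
    IsContMDiffRiemannianBundle (𝓡 3) 1 E3 (fun p : M ↦ TangentSpace (𝓡 3) p) :=
  h.of_le (by norm_cast)

variable [IsContMDiffRiemannianBundle (𝓡 3) ∞ E3 (fun p : M ↦ TangentSpace (𝓡 3) p)]

/-- `cov` is the Levi-Civita connection of the metric; `cov Y p (X p)` is `∇_X Y` at `p`. -/
structure IsLeviCivita
    (cov : CovariantDerivative (𝓡 3) E3 (fun p : M ↦ TangentSpace (𝓡 3) p)) : Prop where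
  smooth : cov.ContMDiffCovariantDerivative ∞
  metric : cov.IsMetricCompatible
  torsionFree : cov.torsion = 0

/-- The curvature `R(X, Y)Z = ∇_X ∇_Y Z - ∇_Y ∇_X Z - ∇_[X, Y] Z` at `p`. -/
def curvature (cov : CovariantDerivative (𝓡 3) E3 (fun p : M ↦ TangentSpace (𝓡 3) p))
    (X Y Z : Π p : M, TangentSpace (𝓡 3) p) (p : M) : TangentSpace (𝓡 3) p :=
  cov (fun q ↦ cov Z q (Y q)) p (X p) - cov (fun q ↦ cov Z q (X q)) p (Y p)
    - cov Z p (mlieBracket (𝓡 3) X Y p)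

/-- The sectional curvature at `p` of the plane spanned by `X p` and `Y p`:
`⟨R(X, Y)Y, X⟩ / (|X|² |Y|² - ⟨X, Y⟩²)`. -/
def sectionalCurvature (cov : CovariantDerivative (𝓡 3) E3 (fun p : M ↦ TangentSpace (𝓡 3) p))
    (X Y : Π p : M, TangentSpace (𝓡 3) p) (p : M) : ℝ :=
  inner ℝ (curvature cov X Y Y p) (X p) /
    (inner ℝ (X p) (X p) * inner ℝ (Y p) (Y p) - inner ℝ (X p) (Y p) ^ 2)

variable (M) in
/-- The metric of `M` has constant sectional curvature `c`: at every point, every tangent plane has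
sectional curvature `c`. Planes are given by two vector fields, smooth near the point, whose values
at the point are linearly independent. -/
def HasConstantSectionalCurvature (c : ℝ) : Prop :=
  ∃ cov : CovariantDerivative (𝓡 3) E3 (fun p : M ↦ TangentSpace (𝓡 3) p), IsLeviCivita cov ∧
    ∀ (U : Set M) (X Y : Π p : M, TangentSpace (𝓡 3) p) (p : M), IsOpen U → p ∈ U →
      SmoothField X U → SmoothField Y U → LinearIndependent ℝ ![X p, Y p] →
      sectionalCurvature cov X Y p = c

end Metric

end ContactMetric
end

namespace ContactMetric

variable {M : Type*} [TopologicalSpace M] [ChartedSpace E3 M]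

/-! Write `A w` for `∇_w N`, where `N` is the Reeb field. Since `α = ⟨N, ·⟩`, the form `dα` is the
antisymmetrisation of `A`, so compatibility says that the skew part of `A` is a constant multiple of
`J`, nonzero by the contact condition. Moreover `N` is a unit geodesic field, so `A` acts on the
planes `N^⊥`.

In constant curvature `c` the operator `A` satisfies the Riccati equation `∇_N A + A² + c = 0` on
`N^⊥`. Its skew part says that `tr A` times the constant skew part of `A` vanishes, hence `tr A = 0`
(`trace_eq_zero`). Its trace then gives `A² = -c` (`sq_add_mul_eq`, `cov_cov_eq`). For `c < 0` there
are real eigenvalues `±a` with `a² = -c`, and locally a frame `N, u, v` with `v = Ju`, `A u = a u`,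
`A v = k u - a v` (`exists_eigenframe`).

Let `ω w = ⟨∇_w u, v⟩`. The Riccati equation gives `ω N = 0`, and the Codazzi equation `R(u, v)N =
0` gives `ω u = ω v = 0` (`inner_cov_eq_zero`). All covariant derivatives of the frame are then
explicit, and the plane of `u` and `v` has curvature `a² > 0`, against `c < 0`. -/

lemma mvfderiv_eq_zero {U : Set M} {p : M} {f : M → ℝ} {a : ℝ} (hU : IsOpen U) (hp : p ∈ U)
    (h : ∀ q ∈ U, f q = a) : mvfderiv (𝓡 3) f p = 0 := by
  have h1 : f =ᶠ[𝓝 p] fun _ ↦ a := Filter.eventuallyEq_of_mem (hU.mem_nhds hp) h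
  unfold mvfderiv
  rw [h1.mfderiv_eq, mfderiv_const]
  rfl

variable [IsManifold (𝓡 3) ∞ M]

/-! ### Smooth local vector fields -/

section Fields

variable {U : Set M} {X Y : Π p : M, TangentSpace (𝓡 3) p} {p : M}

lemma SmoothField.mono {V : Set M} (hX : SmoothField X U) (h : V ⊆ U) : SmoothField X V :=
  ContMDiffOn.mono hX h

lemma SmoothField.diffFieldAt (hX : SmoothField X U) (hU : IsOpen U) (hp : p ∈ U) :
    DiffFieldAt X p :=
  (ContMDiffOn.contMDiffAt hX (hU.mem_nhds hp)).mdifferentiableAt (by simp)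

lemma SmoothField.add (hX : SmoothField X U) (hY : SmoothField Y U) : SmoothField (X + Y) U :=
  ContMDiffOn.add_section hX hY

lemma SmoothField.sub (hX : SmoothField X U) (hY : SmoothField Y U) : SmoothField (X - Y) U :=
  ContMDiffOn.sub_section hX hY

lemma SmoothField.const_smul (a : ℝ) (hX : SmoothField X U) : SmoothField (a • X) U :=
  ContMDiffOn.const_smul_section hX

lemma SmoothField.smul {f : M → ℝ} (hf : ContMDiffOn (𝓡 3) 𝓘(ℝ, ℝ) ∞ f U)
    (hX : SmoothField X U) : SmoothField (f • X) U :=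
  ContMDiffOn.smul_section hf hX

lemma SmoothField.congr (hX : SmoothField X U) (h : ∀ q ∈ U, Y q = X q) : SmoothField Y U :=
  ContMDiffOn.congr hX fun q hq ↦ by rw [h q hq]

lemma SmoothField.apply_end {J : Π p : M, TangentSpace (𝓡 3) p →L[ℝ] TangentSpace (𝓡 3) p}
    (hJ : SmoothEnd J U) (hX : SmoothField X U) : SmoothField (fun q ↦ J q (X q)) U :=
  ContMDiffOn.clm_bundle_apply (b := id) (F₁ := E3) (F₂ := E3)
    (E₁ := fun p : M ↦ TangentSpace (𝓡 3) p) (E₂ := fun p : M ↦ TangentSpace (𝓡 3) p) hJ hX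

/-- Every tangent vector extends to a vector field that is smooth near its base point. -/
lemma exists_smoothField (v : TangentSpace (𝓡 3) p) :
    ∃ (U : Set M) (X : Π p : M, TangentSpace (𝓡 3) p), IsOpen U ∧ p ∈ U ∧ SmoothField X U ∧
      X p = v := by
  obtain ⟨s, hs, h⟩ := FiberBundle.exists_contMDiffOn_extend (k := ∞) (𝓡 3) E3 v
  obtain ⟨U, hUs, hU, hp⟩ := mem_nhds_iff.1 hs
  exact ⟨U, FiberBundle.extend E3 v, hU, hp, ContMDiffOn.mono h hUs, by simp⟩

/-- A field smooth on an open set coincides near each point of it with a globally smooth field. -/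
lemma SmoothField.exists_global [T2Space M] (hX : SmoothField X U) (hU : IsOpen U) (hp : p ∈ U) :
    ∃ Y : Π p : M, TangentSpace (𝓡 3) p, SmoothField Y Set.univ ∧
      ∃ W : Set M, IsOpen W ∧ p ∈ W ∧ W ⊆ U ∧ ∀ q ∈ W, Y q = X q := by
  obtain ⟨f, -, hf⟩ := ((SmoothBumpFunction.nhds_basis_tsupport (I := 𝓡 3) p).mem_iff).1
    (hU.mem_nhds hp)
  refine ⟨(f : M → ℝ) • X, contMDiffOn_univ.2 (ContMDiffOn.smul_section_of_tsupport
    f.contMDiff.contMDiffOn hU hf hX), ?_⟩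
  obtain ⟨W, hW1, hW, hpW⟩ := mem_nhds_iff.1 (f.eventuallyEq_one)
  refine ⟨W ∩ U, hW.inter hU, ⟨hpW, hp⟩, Set.inter_subset_right, fun q hq ↦ ?_⟩
  have : f q = 1 := hW1 hq.1
  simp [this]

end Fields

/-! ### Locality and linearity of a connection -/

section CovariantDerivative

variable {cov : CovariantDerivative (𝓡 3) E3 (fun p : M ↦ TangentSpace (𝓡 3) p)}
  {U : Set M} {X Y : Π p : M, TangentSpace (𝓡 3) p} {p : M}

lemma cov_congr (hX : SmoothField X U) (hU : IsOpen U) (hp : p ∈ U) (h : ∀ q ∈ U, X q = Y q) :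
    cov X p = cov Y p :=
  cov.isCovariantDerivativeOn.congr_of_eqOn (hX.diffFieldAt hU hp)
    ((hX.congr fun q hq ↦ (h q hq).symm).diffFieldAt hU hp) (hU.mem_nhds hp) h

lemma cov_add (hX : SmoothField X U) (hY : SmoothField Y U) (hU : IsOpen U) (hp : p ∈ U) :
    cov (X + Y) p = cov X p + cov Y p :=
  cov.isCovariantDerivativeOn.add (hX.diffFieldAt hU hp) (hY.diffFieldAt hU hp) (Set.mem_univ p)

lemma cov_const_smul (a : ℝ) (hX : SmoothField X U) (hU : IsOpen U) (hp : p ∈ U) :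
    cov (a • X) p = a • cov X p :=
  cov.isCovariantDerivativeOn.smul_const a (hX.diffFieldAt hU hp) (Set.mem_univ p)

lemma cov_sub (hX : SmoothField X U) (hY : SmoothField Y U) (hU : IsOpen U) (hp : p ∈ U) :
    cov (X - Y) p = cov X p - cov Y p := by
  have h := cov_add (cov := cov) hX (hY.const_smul (-1)) hU hp
  rw [cov_const_smul (-1) hY hU hp] at h
  rw [show X - Y = X + (-1 : ℝ) • Y by ext q : 1; simp [sub_eq_add_neg], h]
  simp [sub_eq_add_neg]

lemma curvature_swap (X Y Z : Π p : M, TangentSpace (𝓡 3) p) (p : M) :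
    curvature cov X Y Z p = - curvature cov Y X Z p := by
  simp only [curvature, mlieBracket_swap_apply (V := X) (W := Y), map_neg]
  abel

end CovariantDerivative

/-! ### Levi-Civita connection: skew symmetry of curvature and the Bianchi identity -/

section Connection

variable [RiemannianBundle (fun p : M ↦ TangentSpace (𝓡 3) p)]
  [IsContMDiffRiemannianBundle (𝓡 3) ∞ E3 (fun p : M ↦ TangentSpace (𝓡 3) p)]
  {cov : CovariantDerivative (𝓡 3) E3 (fun p : M ↦ TangentSpace (𝓡 3) p)}
  {U : Set M} {X Y Z W : Π p : M, TangentSpace (𝓡 3) p} {p : M}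

lemma SmoothField.contMDiffOn_inner (hX : SmoothField X U) (hY : SmoothField Y U) :
    ContMDiffOn (𝓡 3) 𝓘(ℝ, ℝ) ∞ (fun q ↦ inner ℝ (X q) (Y q)) U :=
  ContMDiffOn.inner_bundle (F := E3) (E := fun p : M ↦ TangentSpace (𝓡 3) p) (b := id) hX hY

lemma SmoothField.mdifferentiableAt_inner (hX : SmoothField X U) (hY : SmoothField Y U)
    (hU : IsOpen U) (hp : p ∈ U) :
    MDifferentiableAt (𝓡 3) 𝓘(ℝ, ℝ) (fun q ↦ inner ℝ (X q) (Y q)) p :=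
  ((hX.contMDiffOn_inner hY).contMDiffAt (hU.mem_nhds hp)).mdifferentiableAt (by simp)

lemma SmoothField.covDeriv [T2Space M] (hcov : IsLeviCivita cov) (hX : SmoothField X U)
    (hY : SmoothField Y U) (hU : IsOpen U) : SmoothField (fun q ↦ cov Y q (X q)) U := by
  intro p hp
  -- Smoothness of the connection is applied to a globally smooth field, so `Y` is replaced near `p`
  -- by a cut-off extension with the same covariant derivative there.
  obtain ⟨Y', hY', W, hW, hpW, hWU, h⟩ := hY.exists_global hU hp
  have h1 : SmoothEnd (fun q ↦ cov Y' q) Set.univ :=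
    hcov.smooth.contMDiff.contMDiff (σ := Y') (by simpa using! hY')
  have h2 : SmoothField (fun q ↦ cov Y' q (X q)) W :=
    SmoothField.apply_end (ContMDiffOn.mono h1 (Set.subset_univ _)) (hX.mono hWU)
  have h3 : SmoothField (fun q ↦ cov Y q (X q)) W := h2.congr fun q hq ↦ by
    rw [cov_congr (hY.mono hWU) hW hq fun q hq ↦ (h q hq).symm]
  exact (ContMDiffOn.contMDiffAt h3 (hW.mem_nhds hpW)).contMDiffWithinAt

lemma mvfderiv_inner (hcov : IsLeviCivita cov) (hX : SmoothField X U) (hY : SmoothField Y U)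
    (hU : IsOpen U) (hp : p ∈ U) (w : TangentSpace (𝓡 3) p) :
    mvfderiv (𝓡 3) (fun q ↦ inner ℝ (X q) (Y q)) p w =
      inner ℝ (cov X p w) (Y p) + inner ℝ (X p) (cov Y p w) := by
  simpa using hcov.metric.mvfderiv_inner_eq (FiberBundle.extend E3 w) (hX.diffFieldAt hU hp)
    (hY.diffFieldAt hU hp)

lemma inner_cov_add_eq_zero (hcov : IsLeviCivita cov) (hX : SmoothField X U)
    (hY : SmoothField Y U) (hU : IsOpen U) (hp : p ∈ U) {a : ℝ}
    (h : ∀ q ∈ U, inner ℝ (X q) (Y q) = a) (w : TangentSpace (𝓡 3) p) :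
    inner ℝ (cov X p w) (Y p) + inner ℝ (X p) (cov Y p w) = 0 := by
  rw [← mvfderiv_inner hcov hX hY hU hp, mvfderiv_eq_zero hU hp h]
  rfl

lemma mlieBracket_eq (hcov : IsLeviCivita cov) (hX : SmoothField X U)
    (hY : SmoothField Y U) (hU : IsOpen U) (hp : p ∈ U) :
    mlieBracket (𝓡 3) X Y p = cov Y p (X p) - cov X p (Y p) := by
  have : IsManifold (𝓡 3) 2 M := IsManifold.of_le (n := ∞) (by norm_cast)
  exact ((cov.torsion_eq_zero_iff.1 hcov.torsionFree) (hX.diffFieldAt hU hp)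
    (hY.diffFieldAt hU hp)).symm

/-- Vanishing torsion expresses the bracket through covariant derivatives, whose smoothness is
known. -/
lemma SmoothField.lieBracket [T2Space M] (hcov : IsLeviCivita cov) (hX : SmoothField X U)
    (hY : SmoothField Y U) (hU : IsOpen U) : SmoothField (mlieBracket (𝓡 3) X Y) U :=
  ((hX.covDeriv hcov hY hU).sub (hY.covDeriv hcov hX hU)).congr fun _ hq ↦
    mlieBracket_eq hcov hX hY hU hq

/-- The curvature is skew on fields of constant scalar product. -/
lemma inner_curvature_skew [T2Space M] (hcov : IsLeviCivita cov) (hX : SmoothField X U)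
    (hY : SmoothField Y U) (hZ : SmoothField Z U) (hW : SmoothField W U) (hU : IsOpen U)
    (hp : p ∈ U) {a : ℝ} (h : ∀ q ∈ U, inner ℝ (Z q) (W q) = a) :
    inner ℝ (curvature cov X Y Z p) (W p) = - inner ℝ (curvature cov X Y W p) (Z p) := by
  -- Differentiate `⟨Z, W⟩ = a` along `Y`, then along `X`. The two cross terms are symmetric in `X`
  -- and `Y`, so they disappear on antisymmetrising.
  have key : ∀ {X Y : Π p : M, TangentSpace (𝓡 3) p}, SmoothField X U → SmoothField Y U →
      inner ℝ (cov (fun q ↦ cov Z q (Y q)) p (X p)) (W p) +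
        inner ℝ (cov Z p (Y p)) (cov W p (X p)) + (inner ℝ (cov Z p (X p)) (cov W p (Y p)) +
        inner ℝ (Z p) (cov (fun q ↦ cov W q (Y q)) p (X p))) = 0 := by
    intro X Y hX hY
    have hZY := hY.covDeriv hcov hZ hU
    have hWY := hY.covDeriv hcov hW hU
    have e : ∀ q ∈ U, ((fun q ↦ inner ℝ (cov Z q (Y q)) (W q)) +
        fun q ↦ inner ℝ (Z q) (cov W q (Y q))) q = 0 :=
      fun q hq ↦ inner_cov_add_eq_zero hcov hZ hW hU hq h (Y q)
    have e1 := mvfderiv_eq_zero hU hp e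
    rw [mvfderiv_add (hZY.mdifferentiableAt_inner hW hU hp)
      (hZ.mdifferentiableAt_inner hWY hU hp)] at e1
    have e2 := congr($e1 (X p))
    rw [add_apply, mvfderiv_inner hcov hZY hW hU hp,
      mvfderiv_inner hcov hZ hWY hU hp] at e2
    simpa using e2
  have h1 := key hX hY
  have h2 := key hY hX
  have h3 := inner_cov_add_eq_zero hcov hZ hW hU hp h (mlieBracket (𝓡 3) X Y p)
  simp only [curvature, inner_sub_left]
  simp only [real_inner_comm _ (Z p)] at *
  linarith

/-- The first Bianchi identity. -/
lemma curvature_bianchi [T2Space M] (hcov : IsLeviCivita cov) (hX : SmoothField X U)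
    (hY : SmoothField Y U) (hZ : SmoothField Z U) (hU : IsOpen U) (hp : p ∈ U) :
    curvature cov X Y Z p + curvature cov Y Z X p + curvature cov Z X Y p = 0 := by
  -- Zero torsion, used for `[Y, Z]` and again for `[X, [Y, Z]]`. The cyclic sum of the left sides
  -- is the Bianchi sum, that of the right sides is the Jacobi sum.
  have key : ∀ {X Y Z : Π p : M, TangentSpace (𝓡 3) p}, SmoothField X U → SmoothField Y U →
      SmoothField Z U → cov (fun q ↦ cov Z q (Y q)) p (X p) - cov (fun q ↦ cov Y q (Z q)) p (X p)
        - cov X p (mlieBracket (𝓡 3) Y Z p) =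
        mlieBracket (𝓡 3) X (mlieBracket (𝓡 3) Y Z) p := by
    intro X Y Z hX hY hZ
    rw [mlieBracket_eq hcov hX (hY.lieBracket hcov hZ hU) hU hp,
      cov_congr (Y := (fun q ↦ cov Z q (Y q)) - fun q ↦ cov Y q (Z q))
        (hY.lieBracket hcov hZ hU) hU hp (fun q hq ↦ mlieBracket_eq hcov hY hZ hU hq),
      cov_sub (hY.covDeriv hcov hZ hU) (hZ.covDeriv hcov hY hU) hU hp]
    rfl
  have h1 := key hX hY hZ
  have h2 := key hY hZ hX
  have h3 := key hZ hX hY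
  have hmin : minSmoothness ℝ 2 ≤ ∞ := by simp; norm_cast
  have at' : ∀ {X : Π p : M, TangentSpace (𝓡 3) p}, SmoothField X U →
      ContMDiffAt (𝓡 3) ((𝓡 3).prod 𝓘(ℝ, E3)) (minSmoothness ℝ 2)
      (fun p ↦ TotalSpace.mk' E3 (E := fun p : M ↦ TangentSpace (𝓡 3) p) p (X p)) p :=
    fun h ↦ (ContMDiffOn.contMDiffAt h (hU.mem_nhds hp)).of_le hmin
  have : IsManifold (𝓡 3) (minSmoothness ℝ 3) M :=
    IsManifold.of_le (n := ∞) (by simp; norm_cast)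
  have jac := leibniz_identity_mlieBracket_apply (at' hX) (at' hY) (at' hZ)
  have s1 : mlieBracket (𝓡 3) (mlieBracket (𝓡 3) X Y) Z p =
    - mlieBracket (𝓡 3) Z (mlieBracket (𝓡 3) X Y) p :=
      mlieBracket_swap_apply
  have s2 : mlieBracket (𝓡 3) Y (mlieBracket (𝓡 3) X Z) p =
    - mlieBracket (𝓡 3) Y (mlieBracket (𝓡 3) Z X) p := by
    rw [mlieBracket_swap (V := X), ← neg_one_smul ℝ, mlieBracket_const_smul_right
      ((hZ.lieBracket hcov hX hU).diffFieldAt hU hp), neg_one_smul]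
  rw [s1, s2, ← h1, ← h2, ← h3] at jac
  simp only [curvature]
  rw [← sub_eq_zero] at jac
  rw [← jac]
  abel

end Connection

/-! ### Orthonormal frames and curvature components in constant curvature -/

section ConstantCurvature

variable [RiemannianBundle (fun p : M ↦ TangentSpace (𝓡 3) p)]

/-- `X`, `Y`, `Z` is a smooth orthonormal frame on `U`. -/
structure IsOrthonormalFrameOn (X Y Z : Π p : M, TangentSpace (𝓡 3) p) (U : Set M) : Prop where
  smooth₁ : SmoothField X U
  smooth₂ : SmoothField Y U
  smooth₃ : SmoothField Z U
  inner₁₁ : ∀ q ∈ U, inner ℝ (X q) (X q) = 1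
  inner₂₂ : ∀ q ∈ U, inner ℝ (Y q) (Y q) = 1
  inner₃₃ : ∀ q ∈ U, inner ℝ (Z q) (Z q) = 1
  inner₁₂ : ∀ q ∈ U, inner ℝ (X q) (Y q) = 0
  inner₁₃ : ∀ q ∈ U, inner ℝ (X q) (Z q) = 0
  inner₂₃ : ∀ q ∈ U, inner ℝ (Y q) (Z q) = 0

variable {cov : CovariantDerivative (𝓡 3) E3 (fun p : M ↦ TangentSpace (𝓡 3) p)}
  {U : Set M} {X Y Z : Π p : M, TangentSpace (𝓡 3) p} {p : M}

namespace IsOrthonormalFrameOn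

lemma rotate (h : IsOrthonormalFrameOn X Y Z U) : IsOrthonormalFrameOn Y Z X U :=
  ⟨h.2, h.3, h.1, h.5, h.6, h.4, h.9, fun q hq ↦ by rw [real_inner_comm, h.7 q hq],
    fun q hq ↦ by rw [real_inner_comm, h.8 q hq]⟩

lemma swap (h : IsOrthonormalFrameOn X Y Z U) : IsOrthonormalFrameOn Y X Z U :=
  ⟨h.2, h.1, h.3, h.5, h.4, h.6, fun q hq ↦ by rw [real_inner_comm, h.7 q hq], h.9, h.8⟩

lemma decompose (h : IsOrthonormalFrameOn X Y Z U) (hp : p ∈ U) (w : TangentSpace (𝓡 3) p) :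
    w = inner ℝ w (X p) • X p + inner ℝ w (Y p) • Y p + inner ℝ w (Z p) • Z p := by
  have ho : Orthonormal ℝ ![X p, Y p, Z p] := by
    rw [orthonormal_iff_ite]
    have h' := h.rotate.rotate
    intro i j
    fin_cases i <;> fin_cases j <;>
      simp [-inner_self_eq_norm_sq_to_K, h.inner₁₁ p hp, h.inner₂₂ p hp, h.inner₃₃ p hp, h.inner₁₂ p hp, h.inner₁₃ p hp,
        h.inner₂₃ p hp, h.swap.inner₁₂ p hp, h'.inner₁₂ p hp, h'.inner₁₃ p hp]
  have hf : Module.finrank ℝ (TangentSpace (𝓡 3) p) = 3 := finrank_euclideanSpace_fin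
  have : FiniteDimensional ℝ (TangentSpace (𝓡 3) p) := Module.finite_of_finrank_eq_succ hf
  have ht : ⊤ ≤ Submodule.span ℝ (Set.range ![X p, Y p, Z p]) :=
    (ho.linearIndependent.span_eq_top_of_card_eq_finrank' (by simp [hf])).ge
  have := ((OrthonormalBasis.mk ho ht).sum_repr' w).symm
  simpa [Fin.sum_univ_three, real_inner_comm] using this

end IsOrthonormalFrameOn

lemma linearIndependent_pair_of_inner_eq_zero {E : Type*} [NormedAddCommGroup E]
    [InnerProductSpace ℝ E] {x y : E} (hx : x ≠ 0) (hy : y ≠ 0) (h : inner ℝ x y = 0) :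
    LinearIndependent ℝ ![x, y] := by
  rw [LinearIndependent.pair_iff]
  intro s t e
  have h1 := congr(inner ℝ x $e)
  have h2 := congr(inner ℝ $e y)
  simp only [inner_add_left, inner_add_right, inner_smul_left, inner_smul_right, h] at h1 h2
  simpa [hx, hy] using And.intro h1 h2

variable (cov) in
/-- All sectional curvatures computed with `cov` are equal to `c`. -/
def SectionalCurvatureEq (c : ℝ) : Prop :=
  ∀ (U : Set M) (X Y : Π p : M, TangentSpace (𝓡 3) p) (p : M), IsOpen U → p ∈ U →
    SmoothField X U → SmoothField Y U → LinearIndependent ℝ ![X p, Y p] →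
      sectionalCurvature cov X Y p = c

variable {c : ℝ}

namespace IsOrthonormalFrameOn

lemma inner_curvature_self (hc : SectionalCurvatureEq cov c) (h : IsOrthonormalFrameOn X Y Z U)
    (hU : IsOpen U) (hp : p ∈ U) : inner ℝ (curvature cov X Y Y p) (X p) = c := by
  have e := hc U X Y p hU hp h.smooth₁ h.smooth₂ <| by
    apply linearIndependent_pair_of_inner_eq_zero _ _ (h.inner₁₂ p hp)
    · intro e; simpa [e] using h.inner₁₁ p hp
    · intro e; simpa [e] using h.inner₂₂ p hp
  simpa [-inner_self_eq_norm_sq_to_K, sectionalCurvature, h.inner₁₁ p hp, h.inner₂₂ p hp,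
    h.inner₁₂ p hp] using e

variable [IsContMDiffRiemannianBundle (𝓡 3) ∞ E3 (fun p : M ↦ TangentSpace (𝓡 3) p)]

/-- Polarisation: compare the plane of `X + Z` and `Y` with those of `X, Y` and `Z, Y`. The
denominator is `|X + Z|² = 2`, so the numerator is `2c` and the cross terms cancel. -/
lemma inner_curvature_add [T2Space M] (hcov : IsLeviCivita cov) (hc : SectionalCurvatureEq cov c)
    (h : IsOrthonormalFrameOn X Y Z U) (hU : IsOpen U) (hp : p ∈ U) :
    inner ℝ (curvature cov X Y Y p) (Z p) + inner ℝ (curvature cov Z Y Y p) (X p) = 0 := by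
  have hs := h.smooth₁.add h.smooth₃
  have e1 : inner ℝ ((X + Z) p) ((X + Z) p) = 2 := by
    rw [Pi.add_apply, inner_add_left, inner_add_right, inner_add_right, h.inner₁₁ p hp,
      h.inner₃₃ p hp, h.inner₁₃ p hp, h.rotate.inner₂₃ p hp]
    norm_num
  have e2 : inner ℝ ((X + Z) p) (Y p) = 0 := by
    simp [inner_add_left, h.inner₁₂ p hp, h.rotate.rotate.inner₁₃ p hp]
  have e := hc U (X + Z) Y p hU hp hs h.smooth₂ <| by
    apply linearIndependent_pair_of_inner_eq_zero _ _ e2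
    · intro e; norm_num [e] at e1
    · intro e; simpa [e] using h.inner₂₂ p hp
  have e3 : curvature cov (X + Z) Y Y p = curvature cov X Y Y p + curvature cov Z Y Y p := by
    have : IsManifold (𝓡 3) 2 M := IsManifold.of_le (n := ∞) (by norm_cast)
    have a1 : mlieBracket (𝓡 3) (X + Z) Y p = _ :=
      mlieBracket_add_left (h.smooth₁.diffFieldAt hU hp) (h.smooth₃.diffFieldAt hU hp)
    have a2 : (fun q ↦ cov Y q ((X + Z) q)) =
        (fun q ↦ cov Y q (X q)) + fun q ↦ cov Y q (Z q) := by
      ext q : 1; simp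
    simp only [curvature, a1, a2]
    rw [cov_add (h.smooth₁.covDeriv hcov h.smooth₂ hU) (h.smooth₃.covDeriv hcov h.smooth₂ hU)
      hU hp]
    simp
    abel
  have s1 := h.inner_curvature_self hc hU hp
  have s2 := h.rotate.rotate.swap.rotate.inner_curvature_self hc hU hp
  rw [sectionalCurvature, e1, e2, e3, h.inner₂₂ p hp] at e
  simp only [Pi.add_apply, inner_add_left, inner_add_right] at e
  linarith

/-- In constant curvature the mixed components `⟨R(X, Y)Y, Z⟩` vanish. -/
lemma inner_curvature_mixed [T2Space M] (hcov : IsLeviCivita cov)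
    (hc : SectionalCurvatureEq cov c) (h : IsOrthonormalFrameOn X Y Z U) (hU : IsOpen U)
    (hp : p ∈ U) : inner ℝ (curvature cov X Y Y p) (Z p) = 0 := by
  have h1 := h.inner_curvature_add hcov hc hU hp
  -- Paired with `Y` and combined with skewness, Bianchi makes `⟨R(·, Y)Y, ·⟩` symmetric on `X, Z`.
  -- The two summands in `h1` are therefore equal.
  have h2 := congr(inner ℝ $(curvature_bianchi hcov h.smooth₁ h.smooth₂ h.smooth₃ hU hp) (Y p))
  have h3 := inner_curvature_skew hcov h.smooth₁ h.smooth₂ h.smooth₂ h.smooth₃ hU hp h.inner₂₃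
  have h4 := inner_curvature_skew hcov h.smooth₂ h.smooth₃ h.smooth₁ h.smooth₂ hU hp h.inner₁₂
  have h5 := inner_curvature_skew hcov h.smooth₃ h.smooth₁ h.smooth₂ h.smooth₂ hU hp h.inner₂₂
  rw [curvature_swap Y Z Y] at h4
  simp only [inner_add_left, inner_zero_left, inner_neg_left] at h2 h4
  linarith

end IsOrthonormalFrameOn

end ConstantCurvature

/-! ### From a compatible metric to a unit geodesic field -/

section ContactTriple

variable [RiemannianBundle (fun p : M ↦ TangentSpace (𝓡 3) p)]

/-- A unit vector field `N` and an almost complex structure `J` on its orthogonal complement such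
that the skew part of `∇N` is `k J`, where the constant `k` does not vanish. -/
structure IsContactTriple
    (cov : CovariantDerivative (𝓡 3) E3 (fun p : M ↦ TangentSpace (𝓡 3) p))
    (N : Π p : M, TangentSpace (𝓡 3) p)
    (J : Π p : M, TangentSpace (𝓡 3) p →L[ℝ] TangentSpace (𝓡 3) p) (k : ℝ) : Prop where
  smooth_field : SmoothField N Set.univ
  smooth_end : SmoothEnd J Set.univ
  inner_self : ∀ p, inner ℝ (N p) (N p) = 1
  ne_zero : k ≠ 0
  inner_map : ∀ p u, inner ℝ (N p) u = 0 → inner ℝ (N p) (J p u) = 0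
  map_map : ∀ p u, inner ℝ (N p) u = 0 → J p (J p u) = -u
  map_field : ∀ p, J p (N p) = 0
  skew_part : ∀ p u v, inner ℝ (cov N p u) v - inner ℝ (cov N p v) u = k * inner ℝ u (J p v)

variable {cov : CovariantDerivative (𝓡 3) E3 (fun p : M ↦ TangentSpace (𝓡 3) p)}
  {N : Π p : M, TangentSpace (𝓡 3) p}
  {J : Π p : M, TangentSpace (𝓡 3) p →L[ℝ] TangentSpace (𝓡 3) p} {k c : ℝ}
  {U : Set M} {X Y Z u v : Π p : M, TangentSpace (𝓡 3) p} {p : M}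

namespace IsContactTriple

lemma smooth_on (h : IsContactTriple cov N J k) : SmoothField N U :=
  h.smooth_field.mono (Set.subset_univ U)

lemma smooth_map (h : IsContactTriple cov N J k) (hX : SmoothField X U) :
    SmoothField (fun q ↦ J q (X q)) U :=
  SmoothField.apply_end (ContMDiffOn.mono h.smooth_end (Set.subset_univ U)) hX

lemma inner_map_swap (h : IsContactTriple cov N J k) (p : M) (u v : TangentSpace (𝓡 3) p) :
    inner ℝ u (J p v) = - inner ℝ v (J p u) := by
  apply mul_left_cancel₀ h.ne_zero
  have h1 := h.skew_part p u v
  have h2 := h.skew_part p v u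
  linarith

end IsContactTriple

variable [IsContMDiffRiemannianBundle (𝓡 3) ∞ E3 (fun p : M ↦ TangentSpace (𝓡 3) p)]

/-- Expand the invariant formula by metric compatibility and zero torsion: the derivatives of the
extending fields cancel. -/
lemma dForm_eq (hcov : IsLeviCivita cov) {α : Π p : M, TangentSpace (𝓡 3) p →L[ℝ] ℝ}
    (hN : SmoothField N Set.univ) (h : ∀ p u, inner ℝ (N p) u = α p u) (p : M)
    (u v : TangentSpace (𝓡 3) p) :
    dForm α p u v = inner ℝ (cov N p u) v - inner ℝ (cov N p v) u := by
  obtain ⟨s, hs, hu⟩ := FiberBundle.exists_contMDiffOn_extend (k := ∞) (𝓡 3) E3 u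
  obtain ⟨t, ht, hv⟩ := FiberBundle.exists_contMDiffOn_extend (k := ∞) (𝓡 3) E3 v
  obtain ⟨U, hUst, hU, hp⟩ := mem_nhds_iff.1 (Filter.inter_mem hs ht)
  have hX : SmoothField (FiberBundle.extend E3 u) U :=
    ContMDiffOn.mono hu (hUst.trans Set.inter_subset_left)
  have hY : SmoothField (FiberBundle.extend E3 v) U :=
    ContMDiffOn.mono hv (hUst.trans Set.inter_subset_right)
  have hN' := hN.mono (Set.subset_univ U)
  simp only [dForm, dFormFields, ← h]
  rw [mvfderiv_inner hcov hN' hX hU hp, mvfderiv_inner hcov hN' hY hU hp,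
    mlieBracket_eq hcov hX hY hU hp, inner_sub_right]
  simp only [FiberBundle.extend_apply_self]
  ring

lemma MetricCompatibleWith.exists_isContactTriple [Nonempty M] (hcov : IsLeviCivita cov)
    {ξ : Π p : M, Submodule ℝ (TangentSpace (𝓡 3) p)} (h : MetricCompatibleWith ξ) :
    ∃ N J k, IsContactTriple cov N J k := by
  obtain ⟨α, N, J, k, hα, hN, hJ, hNα, hk⟩ := h
  have mem : ∀ p u, inner ℝ (N p) u = 0 → u ∈ ξ p := fun p u e ↦
    (hα.ker_eq p (Set.mem_univ p) u).2 (by rw [← hNα, e])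
  refine ⟨N, J, k, hN.smooth, hJ.smooth, fun p ↦ by rw [hNα, hN.form_eq_one], ?_,
    fun p u e ↦ ?_, fun p u e ↦ hJ.sq p u (mem p u e), hJ.map_reeb,
    fun p u v ↦ by rw [hk, dForm_eq hcov hN.smooth hNα]⟩
  -- If `k = 0` then `dα = 0`, so `α ∧ dα` vanishes.
  · rintro rfl
    obtain ⟨p⟩ := ‹Nonempty M›
    obtain ⟨u, v, w, hvol⟩ := hα.contact p (Set.mem_univ p)
    simp [contactVolume, ← hk] at hvol
  · rw [hNα]
    exact (hα.ker_eq p (Set.mem_univ p) _).1 (hJ.mem p u (mem p u e))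

namespace IsContactTriple

lemma inner_cov_self (h : IsContactTriple cov N J k) (hcov : IsLeviCivita cov) (p : M)
    (w : TangentSpace (𝓡 3) p) : inner ℝ (cov N p w) (N p) = 0 := by
  have e := inner_cov_add_eq_zero hcov h.smooth_field h.smooth_field isOpen_univ
    (Set.mem_univ p) (fun q _ ↦ h.inner_self q) w
  rw [real_inner_comm (cov N p w)] at e
  linarith

/-- The skew part of `∇N` kills `N` because `J N = 0`, and `⟨∇_w N, N⟩ = 0` because `N` has unit
length. -/
lemma cov_self (h : IsContactTriple cov N J k) (hcov : IsLeviCivita cov) (p : M) :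
    cov N p (N p) = 0 := by
  refine ext_inner_right ℝ fun w ↦ ?_
  have e := h.skew_part p (N p) w
  rw [h.inner_map_swap, h.map_field, h.inner_cov_self hcov] at e
  simpa using e

/-- The Riccati equation along the geodesic field `N`. -/
lemma inner_curvature_eq [T2Space M] (h : IsContactTriple cov N J k) (hcov : IsLeviCivita cov)
    (hX : SmoothField X U) (hY : SmoothField Y U) (hU : IsOpen U) (hp : p ∈ U) :
    inner ℝ (curvature cov X N N p) (Y p) =
      - mvfderiv (𝓡 3) (fun q ↦ inner ℝ (cov N q (X q)) (Y q)) p (N p)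
      + inner ℝ (cov N p (X p)) (cov Y p (N p))
      - inner ℝ (cov N p (cov N p (X p) - cov X p (N p))) (Y p) := by
  have hN : SmoothField N U := h.smooth_on
  have e : (fun q ↦ cov N q (N q)) = 0 := funext fun q ↦ h.cov_self hcov q
  rw [curvature, e, mvfderiv_inner hcov (hX.covDeriv hcov hN hU) hY hU hp,
    mlieBracket_eq hcov hX hN hU hp]
  simp [inner_sub_left]

/-- Near a point where a field orthogonal to `N` does not vanish, its normalisation is part of an
orthonormal frame `N`, `u`, `J u`. -/
lemma exists_frame (h : IsContactTriple cov N J k) (hX : SmoothField X U) (hU : IsOpen U)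
    (hp : p ∈ U) (hNX : ∀ q ∈ U, inner ℝ (N q) (X q) = 0) (hXp : X p ≠ 0) :
    ∃ (V : Set M) (f : M → ℝ), IsOpen V ∧ p ∈ V ∧ V ⊆ U ∧
      IsOrthonormalFrameOn N (f • X) (fun q ↦ J q ((f • X) q)) V := by
  have hcont := (hX.contMDiffOn_inner hX).continuousOn
  -- Off the zeros of `X` the factor `1 / |X|` is smooth.
  set V : Set M := U ∩ (fun q ↦ inner ℝ (X q) (X q)) ⁻¹' {0}ᶜ with hVdef
  have hV : IsOpen V := hcont.isOpen_inter_preimage hU isOpen_compl_singleton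
  have hVU : V ⊆ U := Set.inter_subset_left
  have hne : ∀ q ∈ V, inner ℝ (X q) (X q) ≠ 0 := fun q hq ↦ hq.2
  set f : M → ℝ := fun q ↦ (√(inner ℝ (X q) (X q)))⁻¹ with hf
  have hfs : ContMDiffOn (𝓡 3) 𝓘(ℝ, ℝ) ∞ f V := by
    intro q hq
    have h1 : ContDiffAt ℝ ∞ (fun y : ℝ ↦ (√y)⁻¹) (inner ℝ (X q) (X q)) :=
      (Real.contDiffAt_sqrt (hne q hq)).inv
        (Real.sqrt_ne_zero'.2 (lt_of_le_of_ne real_inner_self_nonneg (hne q hq).symm))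
    exact h1.contMDiffAt.comp_contMDiffWithinAt (f := fun q ↦ inner ℝ (X q) (X q)) q
      (((hX.contMDiffOn_inner hX).mono hVU) q hq)
  have hu : SmoothField (f • X) V := SmoothField.smul hfs (hX.mono hVU)
  have huu : ∀ q ∈ V, inner ℝ ((f • X) q) ((f • X) q) = 1 := by
    intro q hq
    have hpos : 0 < inner ℝ (X q) (X q) :=
      lt_of_le_of_ne real_inner_self_nonneg (hne q hq).symm
    have e : inner ℝ ((f • X) q) ((f • X) q) = f q * (f q * inner ℝ (X q) (X q)) := by
      rw [Pi.smul_apply', real_inner_smul_left, real_inner_smul_right]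
    have hs := Real.sq_sqrt hpos.le
    have hs' := (Real.sqrt_pos.2 hpos).ne'
    rw [e, hf]
    field_simp
    linarith
  have hNu : ∀ q ∈ V, inner ℝ (N q) ((f • X) q) = 0 := by
    intro q hq
    rw [Pi.smul_apply', real_inner_smul_right, hNX q (hVU hq), mul_zero]
  refine ⟨V, f, hV, ⟨hp, by simpa using hXp⟩, hVU, h.smooth_on, hu, h.smooth_map hu,
    fun q _ ↦ h.inner_self q, huu, fun q hq ↦ ?_, hNu, fun q hq ↦ h.inner_map q _ (hNu q hq),
    fun q hq ↦ ?_⟩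
  · rw [h.inner_map_swap, h.map_map q _ (hNu q hq), inner_neg_right, huu q hq, neg_neg]
  · have := h.inner_map_swap q ((f • X) q) ((f • X) q)
    linarith

end IsContactTriple

end ContactTriple

/-! ### Riccati and Codazzi equations in an adapted frame -/

section Contradiction

variable [RiemannianBundle (fun p : M ↦ TangentSpace (𝓡 3) p)]
  {cov : CovariantDerivative (𝓡 3) E3 (fun p : M ↦ TangentSpace (𝓡 3) p)}
  {N : Π p : M, TangentSpace (𝓡 3) p}
  {J : Π p : M, TangentSpace (𝓡 3) p →L[ℝ] TangentSpace (𝓡 3) p} {k c a : ℝ}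
  {U : Set M} {X Y u v : Π p : M, TangentSpace (𝓡 3) p} {p : M}

lemma IsContactTriple.inner_cov_sub (h : IsContactTriple cov N J k) (hf : IsOrthonormalFrameOn N u v U)
    (hv : ∀ q ∈ U, v q = J q (u q)) (hp : p ∈ U) :
    inner ℝ (cov N p (u p)) (v p) - inner ℝ (cov N p (v p)) (u p) = -k := by
  rw [h.skew_part, hv p hp, h.map_map p _ (hf.inner₁₂ p hp), inner_neg_right, hf.inner₂₂ p hp]
  ring

variable [IsContMDiffRiemannianBundle (𝓡 3) ∞ E3 (fun p : M ↦ TangentSpace (𝓡 3) p)]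

/-- Orthonormality determines every component from `∇N`, except the connection form `⟨∇_w u, v⟩`. -/
lemma IsOrthonormalFrameOn.cov_snd_eq (hcov : IsLeviCivita cov)
    (hf : IsOrthonormalFrameOn N u v U) (hU : IsOpen U) (hp : p ∈ U)
    (w : TangentSpace (𝓡 3) p) :
    cov u p w = -inner ℝ (cov N p w) (u p) • N p + inner ℝ (cov u p w) (v p) • v p := by
  have e1 := inner_cov_add_eq_zero hcov hf.smooth₁ hf.smooth₂ hU hp hf.inner₁₂ w
  have e2 := inner_cov_add_eq_zero hcov hf.smooth₂ hf.smooth₂ hU hp hf.inner₂₂ w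
  rw [real_inner_comm (cov u p w)] at e1 e2
  conv_lhs => rw [hf.decompose hp (cov u p w)]
  rw [show inner ℝ (cov u p w) (u p) = 0 by linarith,
    show inner ℝ (cov u p w) (N p) = -inner ℝ (cov N p w) (u p) by linarith]
  simp

lemma IsOrthonormalFrameOn.cov_thd_eq (hcov : IsLeviCivita cov)
    (hf : IsOrthonormalFrameOn N u v U) (hU : IsOpen U) (hp : p ∈ U)
    (w : TangentSpace (𝓡 3) p) :
    cov v p w = -inner ℝ (cov N p w) (v p) • N p - inner ℝ (cov u p w) (v p) • u p := by
  have e := inner_cov_add_eq_zero hcov hf.smooth₂ hf.smooth₃ hU hp hf.inner₂₃ w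
  rw [real_inner_comm (cov v p w)] at e
  rw [hf.rotate.rotate.swap.cov_snd_eq hcov hU hp w]
  rw [show inner ℝ (cov v p w) (u p) = - inner ℝ (cov u p w) (v p) by linarith]
  module

namespace IsContactTriple

lemma cov_eq (h : IsContactTriple cov N J k) (hcov : IsLeviCivita cov)
    (hf : IsOrthonormalFrameOn N u v U) (hp : p ∈ U) (w : TangentSpace (𝓡 3) p) :
    cov N p w = inner ℝ (cov N p w) (u p) • u p + inner ℝ (cov N p w) (v p) • v p := by
  conv_lhs => rw [hf.decompose hp (cov N p w), h.inner_cov_self hcov]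
  simp

lemma inner_cov_cov (h : IsContactTriple cov N J k) (hcov : IsLeviCivita cov)
    (hf : IsOrthonormalFrameOn N u v U) (hp : p ∈ U) (w y : TangentSpace (𝓡 3) p) :
    inner ℝ (cov N p (cov N p w)) y = inner ℝ (cov N p w) (u p) * inner ℝ (cov N p (u p)) y +
      inner ℝ (cov N p w) (v p) * inner ℝ (cov N p (v p)) y := by
  conv_lhs => rw [h.cov_eq hcov hf hp w]
  rw [map_add, map_smul, map_smul, inner_add_left, real_inner_smul_left, real_inner_smul_left]

lemma cov_snd_self (h : IsContactTriple cov N J k) (hcov : IsLeviCivita cov)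
    (hf : IsOrthonormalFrameOn N u v U) (hU : IsOpen U) (hp : p ∈ U) :
    cov u p (N p) = inner ℝ (cov u p (N p)) (v p) • v p := by
  conv_lhs => rw [hf.cov_snd_eq hcov hU hp, h.cov_self hcov]
  simp

lemma cov_thd_self (h : IsContactTriple cov N J k) (hcov : IsLeviCivita cov)
    (hf : IsOrthonormalFrameOn N u v U) (hU : IsOpen U) (hp : p ∈ U) :
    cov v p (N p) = -inner ℝ (cov u p (N p)) (v p) • u p := by
  rw [hf.cov_thd_eq hcov hU hp, h.cov_self hcov]
  simp

/-- The component of the Riccati equation along a pair of frame fields. -/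
lemma riccati [T2Space M] (h : IsContactTriple cov N J k) (hcov : IsLeviCivita cov)
    (hf : IsOrthonormalFrameOn N u v U) (hX : SmoothField X U) (hY : SmoothField Y U)
    (hU : IsOpen U) (hp : p ∈ U) :
    inner ℝ (curvature cov X N N p) (Y p) =
      - mvfderiv (𝓡 3) (fun q ↦ inner ℝ (cov N q (X q)) (Y q)) p (N p)
      + inner ℝ (cov N p (X p)) (cov Y p (N p))
      - (inner ℝ (cov N p (X p)) (u p) * inner ℝ (cov N p (u p)) (Y p) +
        inner ℝ (cov N p (X p)) (v p) * inner ℝ (cov N p (v p)) (Y p))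
      + inner ℝ (cov N p (cov X p (N p))) (Y p) := by
  rw [h.inner_curvature_eq hcov hX hY hU hp, map_sub, inner_sub_left,
    h.inner_cov_cov hcov hf hp]
  ring

/-- The trace of `∇N` vanishes. -/
lemma trace_eq_zero [T2Space M] (h : IsContactTriple cov N J k) (hcov : IsLeviCivita cov)
    (hc : SectionalCurvatureEq cov c) (hf : IsOrthonormalFrameOn N u v U)
    (hv : ∀ q ∈ U, v q = J q (u q)) (hU : IsOpen U) (hp : p ∈ U) :
    inner ℝ (cov N p (u p)) (u p) + inner ℝ (cov N p (v p)) (v p) = 0 := by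
  have r1 := h.riccati hcov hf hf.smooth₂ hf.smooth₃ hU hp
  have r2 := h.riccati hcov hf hf.smooth₃ hf.smooth₂ hU hp
  rw [hf.swap.inner_curvature_mixed hcov hc hU hp] at r1
  rw [hf.rotate.rotate.inner_curvature_mixed hcov hc hU hp] at r2
  -- The skew component of `∇N` is the constant `-k`. In `r2 - r1` the terms from the rotation of
  -- `u, v` along `N` cancel, and the quadratic terms leave `k` times the trace.
  have d := mvfderiv_eq_zero hU hp
    (f := (fun q ↦ inner ℝ (cov N q (u q)) (v q)) - fun q ↦ inner ℝ (cov N q (v q)) (u q))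
    (fun q hq ↦ h.inner_cov_sub hf hv hq)
  rw [mvfderiv_sub ((hf.smooth₂.covDeriv hcov hf.smooth₁ hU).mdifferentiableAt_inner
      hf.smooth₃ hU hp) ((hf.smooth₃.covDeriv hcov hf.smooth₁ hU).mdifferentiableAt_inner
      hf.smooth₂ hU hp)] at d
  replace d := congr($d (N p))
  rw [sub_apply, zero_apply] at d
  have e := h.inner_cov_sub hf hv hp
  rw [h.cov_snd_self hcov hf hU hp, h.cov_thd_self hcov hf hU hp, map_smul] at r1 r2
  simp only [real_inner_smul_left, real_inner_smul_right] at r1 r2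
  apply mul_left_cancel₀ h.ne_zero
  linear_combination r2 - r1 + d + (inner ℝ (cov N p (u p)) (u p) +
    inner ℝ (cov N p (v p)) (v p)) * e

/-- The square of `∇N` is `-c`. -/
lemma sq_add_mul_eq [T2Space M] (h : IsContactTriple cov N J k) (hcov : IsLeviCivita cov)
    (hc : SectionalCurvatureEq cov c) (hf : IsOrthonormalFrameOn N u v U)
    (hv : ∀ q ∈ U, v q = J q (u q)) (hU : IsOpen U) (hp : p ∈ U) :
    inner ℝ (cov N p (u p)) (u p) ^ 2 +
      inner ℝ (cov N p (u p)) (v p) * inner ℝ (cov N p (v p)) (u p) = -c := by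
  have r1 := h.riccati hcov hf hf.smooth₂ hf.smooth₂ hU hp
  have r2 := h.riccati hcov hf hf.smooth₃ hf.smooth₃ hU hp
  rw [hf.swap.inner_curvature_self hc hU hp] at r1
  rw [hf.rotate.rotate.inner_curvature_self hc hU hp] at r2
  -- The trace is identically zero, so its derivative along `N` drops out of `r1 + r2`; the rotation
  -- terms cancel too.
  have d := mvfderiv_eq_zero hU hp
    (f := (fun q ↦ inner ℝ (cov N q (u q)) (u q)) + fun q ↦ inner ℝ (cov N q (v q)) (v q))
    (fun q hq ↦ h.trace_eq_zero hcov hc hf hv hU hq)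
  rw [mvfderiv_add ((hf.smooth₂.covDeriv hcov hf.smooth₁ hU).mdifferentiableAt_inner
      hf.smooth₂ hU hp) ((hf.smooth₃.covDeriv hcov hf.smooth₁ hU).mdifferentiableAt_inner
      hf.smooth₃ hU hp)] at d
  replace d := congr($d (N p))
  rw [add_apply, zero_apply] at d
  have e := h.trace_eq_zero hcov hc hf hv hU hp
  rw [h.cov_snd_self hcov hf hU hp] at r1
  rw [h.cov_thd_self hcov hf hU hp] at r2
  simp only [real_inner_smul_left, real_inner_smul_right, map_smul] at r1 r2
  linear_combination (1 / 2) * r1 + (1 / 2) * r2 - (1 / 2) * d +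
    (1 / 2) * (inner ℝ (cov N p (u p)) (u p) - inner ℝ (cov N p (v p)) (v p)) * e

/-- Cayley–Hamilton: a trace-free operator on a plane squares to minus its determinant, here `-c`.
-/
lemma cov_cov_eq [T2Space M] (h : IsContactTriple cov N J k) (hcov : IsLeviCivita cov)
    (hc : SectionalCurvatureEq cov c) (hf : IsOrthonormalFrameOn N u v U)
    (hv : ∀ q ∈ U, v q = J q (u q)) (hU : IsOpen U) (hp : p ∈ U) {w : TangentSpace (𝓡 3) p}
    (hw : inner ℝ (N p) w = 0) : cov N p (cov N p w) = -c • w := by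
  have tr := h.trace_eq_zero hcov hc hf hv hU hp
  have sq := h.sq_add_mul_eq hcov hc hf hv hU hp
  have eu : cov N p (cov N p (u p)) = -c • u p := by
    rw [h.cov_eq hcov hf hp, h.inner_cov_cov hcov hf hp, h.inner_cov_cov hcov hf hp, ← sq,
      eq_neg_of_add_eq_zero_right tr]
    module
  have ev : cov N p (cov N p (v p)) = -c • v p := by
    rw [h.cov_eq hcov hf hp, h.inner_cov_cov hcov hf hp, h.inner_cov_cov hcov hf hp, ← sq,
      eq_neg_of_add_eq_zero_right tr]
    module
  rw [hf.decompose hp w, real_inner_comm, hw]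
  simp only [map_add, map_smul, eu, ev, map_zero, zero_smul]
  module

/-- Near each point there is an adapted frame whose first field is an eigenvector of `∇N`. -/
lemma exists_eigenframe [T2Space M] (h : IsContactTriple cov N J k) (hcov : IsLeviCivita cov)
    (hc : SectionalCurvatureEq cov c) (ha : a ^ 2 = -c) (p : M) :
    ∃ (U : Set M) (u : Π p : M, TangentSpace (𝓡 3) p), IsOpen U ∧ p ∈ U ∧
      IsOrthonormalFrameOn N u (fun q ↦ J q (u q)) U ∧ ∀ q ∈ U, cov N q (u q) = a • u q := by
  have hfin : Module.finrank ℝ (TangentSpace (𝓡 3) p) = 3 := finrank_euclideanSpace_fin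
  obtain ⟨x, hx⟩ : ∃ x : TangentSpace (𝓡 3) p, x ∉ Submodule.span ℝ {N p} := by
    by_contra! hx
    have := finrank_le_one (N p) fun w ↦ Submodule.mem_span_singleton.1 (hx w)
    omega
  obtain ⟨U, X, hU, hp, hX, hXp⟩ := exists_smoothField x
  have hN : SmoothField N U := h.smooth_on
  have hX' := hX.sub (SmoothField.smul (hN.contMDiffOn_inner hX) hN)
  obtain ⟨V, f, hV, hpV, hVU, hf⟩ := h.exists_frame hX' hU hp
    (fun q _ ↦ by
      simp only [Pi.sub_apply, Pi.smul_apply', inner_sub_right, real_inner_smul_right,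
        h.inner_self]
      ring)
    (fun e ↦ hx (by
      rw [Pi.sub_apply, sub_eq_zero, hXp] at e
      rw [e]
      exact Submodule.smul_mem _ _ (Submodule.mem_span_singleton_self _)))
  set u : Π p : M, TangentSpace (𝓡 3) p := f • (X - (fun q ↦ inner ℝ (N q) (X q)) • N) with hu
  set v : Π p : M, TangentSpace (𝓡 3) p := fun q ↦ J q (u q) with hvdef
  have hv : ∀ q ∈ V, v q = J q (u q) := fun q _ ↦ rfl
  -- Since `(A - a)(A + a) = 0` on `N^⊥`, any nonzero `(A + a)Y` is an eigenvector for `a`, and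
  -- normalising it preserves this.
  have key : ∀ Y : Π p : M, TangentSpace (𝓡 3) p, SmoothField Y V →
      (∀ q ∈ V, inner ℝ (N q) (Y q) = 0) → cov N p (Y p) + a • Y p ≠ 0 →
      ∃ (U : Set M) (u : Π p : M, TangentSpace (𝓡 3) p), IsOpen U ∧ p ∈ U ∧
        IsOrthonormalFrameOn N u (fun q ↦ J q (u q)) U ∧
        ∀ q ∈ U, cov N q (u q) = a • u q := by
    intro Y hY hNY hne
    have hZ := (hY.covDeriv hcov hf.smooth₁ hV).add (hY.const_smul a)
    obtain ⟨W, g, hW, hpW, hWV, hg⟩ := h.exists_frame hZ hV hpV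
      (fun q hq ↦ by
        simp only [Pi.add_apply, Pi.smul_apply, inner_add_right, real_inner_smul_right,
          hNY q hq, mul_zero, add_zero]
        rw [real_inner_comm, h.inner_cov_self hcov]) hne
    refine ⟨W, _, hW, hpW, hg, fun q hq ↦ ?_⟩
    have hq' := hWV hq
    have sq : cov N q (cov N q (Y q)) = a ^ 2 • Y q := by
      rw [h.cov_cov_eq hcov hc hf hv hV hq' (hNY q hq'), ha]
    simp only [Pi.smul_apply', Pi.add_apply, Pi.smul_apply, map_smul, map_add, sq]
    module
  -- If `A + a` killed both `u` and `v` at `p`, then `A = -a` on `N^⊥` would be symmetric there,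
  -- contradicting `k ≠ 0`.
  by_cases h1 : cov N p (u p) + a • u p = 0
  · refine key v hf.smooth₃ hf.inner₁₃ fun h2 ↦ h.ne_zero ?_
    have e1 := congr(inner ℝ $h1 (v p))
    have e2 := congr(inner ℝ $h2 (u p))
    rw [inner_add_left, real_inner_smul_left, hf.inner₂₃ p hpV, inner_zero_left] at e1
    rw [inner_add_left, real_inner_smul_left, hf.rotate.swap.inner₁₂ p hpV,
      inner_zero_left] at e2
    linarith [h.inner_cov_sub hf hv hpV]
  · exact key u hf.smooth₂ hf.inner₁₂ h1

/-- In an eigenframe, the Codazzi equations make the connection form of `N`-orthogonal fields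
vanish. -/
lemma inner_cov_eq_zero [T2Space M] (h : IsContactTriple cov N J k) (hcov : IsLeviCivita cov)
    (hc : SectionalCurvatureEq cov c) (ha : a ^ 2 = -c) (ha0 : a ≠ 0)
    (hf : IsOrthonormalFrameOn N u v U) (hu : ∀ q ∈ U, cov N q (u q) = a • u q)
    (hv : ∀ q ∈ U, cov N q (v q) = k • u q - a • v q) (hU : IsOpen U) (hp : p ∈ U)
    (w : TangentSpace (𝓡 3) p) : inner ℝ (cov u p w) (v p) = 0 := by
  have ip : inner ℝ (u p) (u p) = 1 ∧ inner ℝ (v p) (v p) = 1 ∧ inner ℝ (u p) (v p) = 0 ∧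
      inner ℝ (v p) (u p) = 0 :=
    ⟨hf.inner₂₂ p hp, hf.inner₃₃ p hp, hf.inner₂₃ p hp, hf.rotate.swap.inner₁₂ p hp⟩
  obtain ⟨iuu, ivv, iuv, ivu⟩ := ip
  -- The `uu` component of Riccati reads `c = -a² + k ω(N)`, because `⟨A u, u⟩ = a` is constant.
  have hN0 : inner ℝ (cov u p (N p)) (v p) = 0 := by
    have r := h.riccati hcov hf hf.smooth₂ hf.smooth₂ hU hp
    rw [hf.swap.inner_curvature_self hc hU hp, h.cov_snd_self hcov hf hU hp,
      mvfderiv_eq_zero hU hp (a := a)] at r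
    · simp only [map_smul, hu p hp, hv p hp, real_inner_smul_left, real_inner_smul_right, iuu, iuv,
        ivu, zero_apply, inner_sub_left] at r
      apply mul_left_cancel₀ h.ne_zero
      linear_combination ha - r
    · intro q hq
      rw [hu q hq, real_inner_smul_left, hf.inner₂₂ q hq, mul_one]
  have cod : curvature cov u v N p = (2 * a * inner ℝ (cov u p (u p)) (v p) +
      k * inner ℝ (cov u p (v p)) (v p)) • u p + (k * inner ℝ (cov u p (u p)) (v p) -
      2 * a * inner ℝ (cov u p (v p)) (v p)) • v p := by
    have e1 : cov (fun q ↦ cov N q (v q)) p = k • cov u p - a • cov v p := by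
      rw [cov_congr (Y := k • u - a • v) (hf.smooth₃.covDeriv hcov hf.smooth₁ hU) hU hp hv,
        cov_sub (hf.smooth₂.const_smul k) (hf.smooth₃.const_smul a) hU hp,
        cov_const_smul k hf.smooth₂ hU hp, cov_const_smul a hf.smooth₃ hU hp]
    have e2 : cov (fun q ↦ cov N q (u q)) p = a • cov u p := by
      rw [cov_congr (Y := a • u) (hf.smooth₂.covDeriv hcov hf.smooth₁ hU) hU hp hu,
        cov_const_smul a hf.smooth₂ hU hp]
    have e3 := hf.cov_snd_eq hcov hU hp (u p)
    have e4 := hf.cov_snd_eq hcov hU hp (v p)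
    have e5 := hf.cov_thd_eq hcov hU hp (u p)
    simp only [hu p hp, hv p hp, inner_sub_left, real_inner_smul_left, iuu, iuv, ivu] at e3 e4 e5
    generalize inner ℝ (cov u p (u p)) (v p) = x at *
    generalize inner ℝ (cov u p (v p)) (v p) = y at *
    rw [curvature, e1, e2, mlieBracket_eq hcov hf.smooth₂ hf.smooth₃ hU hp]
    simp only [sub_apply, smul_apply, e3, e4, e5, map_sub,
      map_add, map_smul, hu p hp, hv p hp, h.cov_self hcov]
    module
  have c1 : inner ℝ (curvature cov u v N p) (u p) = 0 := by
    rw [inner_curvature_skew hcov hf.smooth₂ hf.smooth₃ hf.smooth₁ hf.smooth₂ hU hp hf.inner₁₂,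
      curvature_swap, inner_neg_left, hf.rotate.swap.inner_curvature_mixed hcov hc hU hp]
    simp
  have c2 : inner ℝ (curvature cov u v N p) (v p) = 0 := by
    rw [inner_curvature_skew hcov hf.smooth₂ hf.smooth₃ hf.smooth₁ hf.smooth₃ hU hp hf.inner₁₃,
      hf.rotate.inner_curvature_mixed hcov hc hU hp]
    simp
  rw [cod] at c1 c2
  simp only [inner_add_left, real_inner_smul_left, iuu, iuv, ivu, ivv] at c1 c2
  -- Up to sign, the determinant of the linear system `c1`, `c2` in `ω(u)` and `ω(v)`.
  have hd : 4 * a ^ 2 + k ^ 2 ≠ 0 := by positivity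
  have hu0 : inner ℝ (cov u p (u p)) (v p) = 0 := by
    apply mul_left_cancel₀ hd
    linear_combination 2 * a * c1 + k * c2
  have hv0 : inner ℝ (cov u p (v p)) (v p) = 0 := by
    apply mul_left_cancel₀ hd
    linear_combination k * c1 - 2 * a * c2
  rw [hf.decompose hp w]
  simp [inner_add_left, real_inner_smul_left, hN0, hu0, hv0]

/-- A contact triple does not exist in constant negative curvature. -/
theorem nonneg_of_sectionalCurvatureEq [T2Space M] [Nonempty M] (h : IsContactTriple cov N J k)
    (hcov : IsLeviCivita cov) (hc : SectionalCurvatureEq cov c) : 0 ≤ c := by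
  by_contra! hc0
  obtain ⟨a, ha, ha0⟩ : ∃ a : ℝ, a ^ 2 = -c ∧ a ≠ 0 :=
    ⟨√(-c), Real.sq_sqrt (by linarith), (Real.sqrt_pos.2 (by linarith)).ne'⟩
  obtain ⟨p⟩ := ‹Nonempty M›
  obtain ⟨U, u, hU, hp, hf, hu⟩ := h.exists_eigenframe hcov hc ha p
  set v : Π p : M, TangentSpace (𝓡 3) p := fun q ↦ J q (u q)
  have hv : ∀ q ∈ U, cov N q (v q) = k • u q - a • v q := by
    intro q hq
    have e := h.inner_cov_sub hf (fun q _ ↦ rfl) hq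
    have tr := h.trace_eq_zero hcov hc hf (fun q _ ↦ rfl) hU hq
    rw [hu q hq, real_inner_smul_left, hf.inner₂₃ q hq] at e
    rw [hu q hq, real_inner_smul_left, hf.inner₂₂ q hq] at tr
    rw [h.cov_eq hcov hf hq, show inner ℝ (cov N q (v q)) (u q) = k by linarith,
      show inner ℝ (cov N q (v q)) (v q) = -a by linarith]
    module
  have hω : ∀ q ∈ U, ∀ w, inner ℝ (cov u q w) (v q) = 0 := fun q hq w ↦
    h.inner_cov_eq_zero hcov hc ha ha0 hf hu hv hU hq w
  have huv : ∀ q ∈ U, cov v q (u q) = 0 := by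
    intro q hq
    rw [hf.cov_thd_eq hcov hU hq, hω q hq, hu q hq, real_inner_smul_left, hf.inner₂₃ q hq]
    simp
  have hvv : ∀ q ∈ U, cov v q (v q) = a • N q := by
    intro q hq
    rw [hf.cov_thd_eq hcov hU hq, hω q hq, hv q hq, inner_sub_left, real_inner_smul_left,
      real_inner_smul_left, hf.inner₂₃ q hq, hf.inner₃₃ q hq]
    simp
  have hvu : cov u p (v p) = -k • N p := by
    rw [hf.cov_snd_eq hcov hU hp, hω p hp, hv p hp, inner_sub_left, real_inner_smul_left,
      real_inner_smul_left, hf.inner₂₂ p hp, hf.rotate.swap.inner₁₂ p hp]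
    simp
  have hNv : cov v p (N p) = 0 := by
    rw [h.cov_thd_self hcov hf hU hp, hω p hp]
    simp
  -- Here `∇_u ∇_v v = a ∇_u N = a² u`, while `∇_u v = 0` and `[u, v] = k N` with `∇_N v = 0`. So
  -- `e` becomes `a² = c`.
  have e := hf.rotate.inner_curvature_self hc hU hp
  rw [curvature, cov_congr (Y := a • N) (hf.smooth₃.covDeriv hcov hf.smooth₃ hU) hU hp hvv,
    cov_congr (Y := 0) (hf.smooth₂.covDeriv hcov hf.smooth₃ hU) hU hp huv,
    cov_const_smul a hf.smooth₁ hU hp, mlieBracket_eq hcov hf.smooth₂ hf.smooth₃ hU hp, huv p hp,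
    hvu] at e
  simp only [smul_apply, hu p hp, CovariantDerivative.zero, map_sub, map_smul,
    hNv, Pi.zero_apply, zero_apply, map_zero, smul_zero, sub_zero,
    real_inner_smul_left, hf.inner₂₂ p hp] at e
  nlinarith

end IsContactTriple

end Contradiction

end ContactMetric

theorem mainTheorem2 {M : Type*} [TopologicalSpace M] [T2Space M] [SecondCountableTopology M]
    [Nonempty M] [ChartedSpace (EuclideanSpace ℝ (Fin 3)) M] [IsManifold (𝓡 3) ∞ M]
    [RiemannianBundle (fun p : M ↦ TangentSpace (𝓡 3) p)]
    [IsContMDiffRiemannianBundle (𝓡 3) ∞ (EuclideanSpace ℝ (Fin 3))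
      (fun p : M ↦ TangentSpace (𝓡 3) p)]
    (c : ℝ) (hc : c < 0) (hcurv : ContactMetric.HasConstantSectionalCurvature M c)
    (ξ : Π p : M, Submodule ℝ (TangentSpace (𝓡 3) p))
    (hξ : ContactMetric.IsContactStructure ξ) :
    ¬ ContactMetric.MetricCompatibleWith ξ := by
  obtain ⟨cov, hcov, hsec⟩ := hcurv
  intro h
  obtain ⟨N, J, k, htriple⟩ := h.exists_isContactTriple hcov
  exact absurd (htriple.nonneg_of_sectionalCurvatureEq hcov hsec) (not_le.2 hc)
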